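/- Let $R$ be a prime ring, that is, a nonzero associative ring, not necessarily with unity, such that for $a,b\in R$, $aRb=0$ implies $a=0$ or $b=0$. Let $Z(R)$ be its center, let $Q_s(R)$ be its Martindale symmetric ring of quotients, and let $C$ be the extended centroid of $R$, i.e. the center of $Q_s(R)$ (a field). Write $[a,b]=ab-ba$; for subsets $A,B$ let $[A,B]$ (resp. $AB$) be the additive subgroup generated by all $[a,b]$ (resp. $ab$) with $a\in A$, $b\in B$, and let $A^m$ be the corresponding $m$-fold product, for $m\ge 1$. For $A\subseteq R$, $AC$ is thus the $C$-linear span of $A$ in $Q_s(R)$. A Lie ideal of $R$ is an additive subgroup $L$ with $[L,R]\subseteq L$; it is noncentral if $L\not\subseteq Z(R)$. The ring $R$ is called exceptional if $\operatorname{char}R=2$ and $\dim_C RC=4$. Let $K$ and $L$ be noncentral Lie ideals of $R$ and let $m,n$ be positive integers. Then the following are equivalent: (i) $[K^m,L^n]=0$; (ii) $[K,L]=0$; (iii) $R$ is exceptional, and $KC=LC=Ca+C$ for every $a\in L\setminus Z(R)$. -/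

import Mathlib

namespace PrimeLie

universe u

section Additive

variable {R : Type u} [NonUnitalRing R]

/-- `[A, B]`: the additive subgroup generated by all `ab - ba` with `a ∈ A`, `b ∈ B`. -/
def commutator (A B : Set R) : AddSubgroup R :=
  AddSubgroup.closure {x | ∃ a ∈ A, ∃ b ∈ B, x = a * b - b * a}

/-- `AB`: the additive subgroup generated by all `ab` with `a ∈ A`, `b ∈ B`. -/
def product (A B : Set R) : AddSubgroup R :=
  AddSubgroup.closure {x | ∃ a ∈ A, ∃ b ∈ B, x = a * b}

/-- `A ^ m` for `m ≥ 1`: `A ^ 1` is the additive subgroup generated by `A`, and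
`A ^ (m + 1) = A ^ m A`. The ring need not have a unit, so exponent `0` has no meaning; the value
there is arbitrary. -/
def power (A : Set R) : ℕ → AddSubgroup R
  | 0 => ⊥
  | 1 => AddSubgroup.closure A
  | (m + 2) => product (power A (m + 1) : Set R) A

/-- An additive subgroup `L` is a Lie ideal if `[L, R] ⊆ L`. -/
def IsLieIdeal (L : AddSubgroup R) : Prop :=
  commutator (L : Set R) Set.univ ≤ L

/-- An additive subgroup is central if it is contained in the center `Z(R)`. -/
def IsCentral (L : AddSubgroup R) : Prop :=
  ∀ a ∈ L, a ∈ NonUnitalSubring.center R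

end Additive

/-- A (not necessarily unital) nonzero ring is prime if `aRb = 0` implies `a = 0` or `b = 0`. -/
class IsPrimeRing (R : Type u) [NonUnitalRing R] : Prop extends Nontrivial R where
  eq_zero_or_eq_zero : ∀ a b : R, (∀ r : R, a * r * b = 0) → a = 0 ∨ b = 0

section Ideals

variable {R : Type u} [NonUnitalRing R]

/-- The product of two two-sided ideals. -/
def idealMul (I J : TwoSidedIdeal R) : TwoSidedIdeal R :=
  TwoSidedIdeal.mk' (product (I : Set R) (J : Set R) : Set R)
    (zero_mem _) (fun hx hy => add_mem hx hy) (fun hx => neg_mem hx)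
    (by
      intro x y hy
      refine AddSubgroup.closure_induction (p := fun y _ => x * y ∈ product (I : Set R) (J : Set R))
        ?_ ?_ ?_ ?_ hy
      · rintro _ ⟨a, ha, b, hb, rfl⟩
        exact AddSubgroup.subset_closure
          ⟨x * a, I.mul_mem_left x a ha, b, hb, (mul_assoc x a b).symm⟩
      · simp
      · intro y z _ _ h1 h2
        rw [mul_add]
        exact add_mem h1 h2
      · intro y _ h
        rw [mul_neg]
        exact neg_mem h)
    (by
      intro y x hy
      refine AddSubgroup.closure_induction (p := fun y _ => y * x ∈ product (I : Set R) (J : Set R))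
        ?_ ?_ ?_ ?_ hy
      · rintro _ ⟨a, ha, b, hb, rfl⟩
        exact AddSubgroup.subset_closure
          ⟨a, ha, b * x, J.mul_mem_right b x hb, mul_assoc a b x⟩
      · simp
      · intro y z _ _ h1 h2
        rw [add_mul]
        exact add_mem h1 h2
      · intro y _ h
        rw [neg_mul]
        exact neg_mem h)

theorem mem_idealMul {I J : TwoSidedIdeal R} {x : R} :
    x ∈ idealMul I J ↔ x ∈ product (I : Set R) (J : Set R) := by
  simp [idealMul]

theorem mul_mem_idealMul {I J : TwoSidedIdeal R} {a b : R} (ha : a ∈ I) (hb : b ∈ J) :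
    a * b ∈ idealMul I J :=
  mem_idealMul.2 (AddSubgroup.subset_closure ⟨a, ha, b, hb, rfl⟩)

theorem idealMul_induction {I J : TwoSidedIdeal R} {p : R → Prop}
    (hmul : ∀ a ∈ I, ∀ b ∈ J, p (a * b)) (h0 : p 0)
    (hadd : ∀ x ∈ idealMul I J, ∀ y ∈ idealMul I J, p x → p y → p (x + y))
    (hneg : ∀ x ∈ idealMul I J, p x → p (-x)) {x : R} (hx : x ∈ idealMul I J) : p x := by
  refine AddSubgroup.closure_induction (p := fun x _ => p x) ?_ h0 ?_ ?_ (mem_idealMul.1 hx)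
  · rintro _ ⟨a, ha, b, hb, rfl⟩
    exact hmul a ha b hb
  · intro x y hx hy
    exact hadd x (mem_idealMul.2 hx) y (mem_idealMul.2 hy)
  · intro x hx
    exact hneg x (mem_idealMul.2 hx)

theorem idealMul_le_left {I J : TwoSidedIdeal R} : idealMul I J ≤ I := by
  intro x hx
  exact idealMul_induction (fun a ha b _ => I.mul_mem_right a b ha) I.zero_mem
    (fun _ _ _ _ h1 h2 => I.add_mem h1 h2) (fun _ _ h => I.neg_mem h) hx

theorem idealMul_le_right {I J : TwoSidedIdeal R} : idealMul I J ≤ J := by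
  intro x hx
  exact idealMul_induction (fun a _ b hb => J.mul_mem_left a b hb) J.zero_mem
    (fun _ _ _ _ h1 h2 => J.add_mem h1 h2) (fun _ _ h => J.neg_mem h) hx

theorem idealMul_mono {I I' J J' : TwoSidedIdeal R} (h : I ≤ I') (k : J ≤ J') :
    idealMul I J ≤ idealMul I' J' := by
  intro x hx
  exact idealMul_induction (fun a ha b hb => mul_mem_idealMul (h ha) (k hb)) (zero_mem _)
    (fun _ _ _ _ h1 h2 => add_mem h1 h2) (fun _ _ h => neg_mem h) hx

theorem exists_mem_ne_zero {I : TwoSidedIdeal R} (hI : I ≠ ⊥) : ∃ a ∈ I, a ≠ 0 := by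
  by_contra h
  push Not at h
  refine hI (le_antisymm (fun x hx => ?_) bot_le)
  rw [h x hx]
  exact zero_mem _

theorem ne_bot_of_mem {I : TwoSidedIdeal R} {a : R} (ha : a ∈ I) (h : a ≠ 0) : I ≠ ⊥ := by
  rintro rfl
  exact h (by simpa using ha)

variable [IsPrimeRing R]

theorem idealMul_ne_bot {I J : TwoSidedIdeal R} (hI : I ≠ ⊥) (hJ : J ≠ ⊥) : idealMul I J ≠ ⊥ := by
  obtain ⟨a, ha, ha0⟩ := exists_mem_ne_zero hI
  obtain ⟨b, hb, hb0⟩ := exists_mem_ne_zero hJ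
  have : ∃ r : R, a * r * b ≠ 0 := by
    by_contra h
    push Not at h
    exact (IsPrimeRing.eq_zero_or_eq_zero a b h).elim ha0 hb0
  obtain ⟨r, hr⟩ := this
  exact ne_bot_of_mem (mul_mem_idealMul (I.mul_mem_right a r ha) hb) hr

theorem inf_ne_bot {I J : TwoSidedIdeal R} (hI : I ≠ ⊥) (hJ : J ≠ ⊥) : I ⊓ J ≠ ⊥ := by
  intro h
  refine idealMul_ne_bot hI hJ (le_antisymm ?_ bot_le)
  rw [← h]
  exact le_inf idealMul_le_left idealMul_le_right

theorem top_ne_bot' : (⊤ : TwoSidedIdeal R) ≠ ⊥ := by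
  obtain ⟨a, ha⟩ := exists_ne (0 : R)
  exact ne_bot_of_mem (I := ⊤) (a := a) trivial ha

end Ideals

/-- A representative of an element `q` of the Martindale symmetric ring of quotients of `R`: a
nonzero two-sided ideal `dom`, a right `R`-module map `x ↦ q x` from `dom` to `R` and a left
`R`-module map `x ↦ x q` from `dom` to `R` with `(x q) y = x (q y)`. The two maps are
recorded as functions on `R`; only their restrictions to `dom` matter. -/
structure QuotientRep (R : Type u) [NonUnitalRing R] where
  dom : TwoSidedIdeal R
  dom_ne_bot : dom ≠ ⊥
  left : R → R
  right : R → R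
  left_add : ∀ x ∈ dom, ∀ y ∈ dom, left (x + y) = left x + left y
  left_mul : ∀ x ∈ dom, ∀ r : R, left (x * r) = left x * r
  right_add : ∀ x ∈ dom, ∀ y ∈ dom, right (x + y) = right x + right y
  right_mul : ∀ x ∈ dom, ∀ r : R, right (r * x) = r * right x
  compat : ∀ x ∈ dom, ∀ y ∈ dom, right x * y = x * left y

namespace QuotientRep

variable {R : Type u} [NonUnitalRing R]

theorem left_zero (p : QuotientRep R) : p.left 0 = 0 := by
  simpa using p.left_add 0 p.dom.zero_mem 0 p.dom.zero_mem

theorem right_zero (p : QuotientRep R) : p.right 0 = 0 := by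
  simpa using p.right_add 0 p.dom.zero_mem 0 p.dom.zero_mem

theorem left_neg (p : QuotientRep R) {x : R} (hx : x ∈ p.dom) : p.left (-x) = -p.left x := by
  have h := p.left_add (-x) (p.dom.neg_mem hx) x hx
  rw [neg_add_cancel, left_zero] at h
  exact eq_neg_of_add_eq_zero_left h.symm

theorem right_neg (p : QuotientRep R) {x : R} (hx : x ∈ p.dom) : p.right (-x) = -p.right x := by
  have h := p.right_add (-x) (p.dom.neg_mem hx) x hx
  rw [neg_add_cancel, right_zero] at h
  exact eq_neg_of_add_eq_zero_left h.symm

theorem left_mem (p : QuotientRep R) {I J : TwoSidedIdeal R} (hI : I ≤ p.dom) {x : R}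
    (hx : x ∈ idealMul I J) : p.left x ∈ J := by
  refine idealMul_induction (p := fun x => p.left x ∈ J) ?_ ?_ ?_ ?_ hx
  · intro a ha b hb
    rw [p.left_mul a (hI ha)]
    exact J.mul_mem_left _ _ hb
  · rw [p.left_zero]
    exact J.zero_mem
  · intro x hx y hy h1 h2
    rw [p.left_add x (hI (idealMul_le_left hx)) y (hI (idealMul_le_left hy))]
    exact J.add_mem h1 h2
  · intro x hx h
    rw [p.left_neg (hI (idealMul_le_left hx))]
    exact J.neg_mem h

theorem right_mem (p : QuotientRep R) {I J : TwoSidedIdeal R} (hJ : J ≤ p.dom) {x : R}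
    (hx : x ∈ idealMul I J) : p.right x ∈ I := by
  refine idealMul_induction (p := fun x => p.right x ∈ I) ?_ ?_ ?_ ?_ hx
  · intro a ha b hb
    rw [p.right_mul b (hJ hb)]
    exact I.mul_mem_right _ _ ha
  · rw [p.right_zero]
    exact I.zero_mem
  · intro x hx y hy h1 h2
    rw [p.right_add x (hJ (idealMul_le_right hx)) y (hJ (idealMul_le_right hy))]
    exact I.add_mem h1 h2
  · intro x hx h
    rw [p.right_neg (hJ (idealMul_le_right hx))]
    exact I.neg_mem h

variable [IsPrimeRing R]

/-- Two representatives are identified if they agree on some nonzero ideal contained in both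
domains. -/
instance setoid (R : Type u) [NonUnitalRing R] [IsPrimeRing R] : Setoid (QuotientRep R) where
  r p q := ∃ J : TwoSidedIdeal R, J ≠ ⊥ ∧ J ≤ p.dom ∧ J ≤ q.dom ∧
    ∀ x ∈ J, p.left x = q.left x ∧ p.right x = q.right x
  iseqv :=
    { refl := fun p => ⟨p.dom, p.dom_ne_bot, le_rfl, le_rfl, fun _ _ => ⟨rfl, rfl⟩⟩
      symm := fun ⟨J, h0, h1, h2, h⟩ =>
        ⟨J, h0, h2, h1, fun x hx => ⟨(h x hx).1.symm, (h x hx).2.symm⟩⟩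
      trans := fun ⟨J, h0, h1, _, h⟩ ⟨J', h0', _, h2', h'⟩ =>
        ⟨J ⊓ J', inf_ne_bot h0 h0', inf_le_left.trans h1, inf_le_right.trans h2', fun x hx =>
          have hJ : x ∈ J := (inf_le_left : J ⊓ J' ≤ J) hx
          have hJ' : x ∈ J' := (inf_le_right : J ⊓ J' ≤ J') hx
          ⟨(h x hJ).1.trans (h' x hJ').1, (h x hJ).2.trans (h' x hJ').2⟩⟩ }

theorem equiv_of_agree {p q : QuotientRep R}
    (h : ∀ x ∈ p.dom, x ∈ q.dom → p.left x = q.left x ∧ p.right x = q.right x) : p ≈ q :=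
  ⟨p.dom ⊓ q.dom, inf_ne_bot p.dom_ne_bot q.dom_ne_bot, inf_le_left, inf_le_right, fun x hx =>
    h x ((inf_le_left : p.dom ⊓ q.dom ≤ p.dom) hx) ((inf_le_right : p.dom ⊓ q.dom ≤ q.dom) hx)⟩

/-- Left and right multiplication by an element of `R`. -/
def ofElem (r : R) : QuotientRep R where
  dom := ⊤
  dom_ne_bot := top_ne_bot'
  left x := r * x
  right x := x * r
  left_add x _ y _ := mul_add r x y
  left_mul x _ s := (mul_assoc r x s).symm
  right_add x _ y _ := add_mul x y r
  right_mul x _ s := mul_assoc s x r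
  compat x _ y _ := mul_assoc x r y

/-- The identity on `R`. -/
def one (R : Type u) [NonUnitalRing R] [IsPrimeRing R] : QuotientRep R where
  dom := ⊤
  dom_ne_bot := top_ne_bot'
  left x := x
  right x := x
  left_add _ _ _ _ := rfl
  left_mul _ _ _ := rfl
  right_add _ _ _ _ := rfl
  right_mul _ _ _ := rfl
  compat _ _ _ _ := rfl

/-- The pointwise negative. -/
def neg (p : QuotientRep R) : QuotientRep R where
  dom := p.dom
  dom_ne_bot := p.dom_ne_bot
  left x := -p.left x
  right x := -p.right x
  left_add x hx y hy := by rw [p.left_add x hx y hy, neg_add]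
  left_mul x hx r := by rw [p.left_mul x hx r, neg_mul]
  right_add x hx y hy := by rw [p.right_add x hx y hy, neg_add]
  right_mul x hx r := by rw [p.right_mul x hx r, mul_neg]
  compat x hx y hy := by rw [neg_mul, mul_neg, p.compat x hx y hy]

/-- The pointwise sum, on the intersection of the domains. -/
def add (p q : QuotientRep R) : QuotientRep R where
  dom := p.dom ⊓ q.dom
  dom_ne_bot := inf_ne_bot p.dom_ne_bot q.dom_ne_bot
  left x := p.left x + q.left x
  right x := p.right x + q.right x
  left_add x hx y hy := by
    rw [p.left_add x (inf_le_left (a := p.dom) hx) y (inf_le_left (a := p.dom) hy),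
      q.left_add x (inf_le_right (a := p.dom) hx) y (inf_le_right (a := p.dom) hy)]
    abel
  left_mul x hx r := by
    rw [p.left_mul x (inf_le_left (a := p.dom) hx), q.left_mul x (inf_le_right (a := p.dom) hx),
      add_mul]
  right_add x hx y hy := by
    rw [p.right_add x (inf_le_left (a := p.dom) hx) y (inf_le_left (a := p.dom) hy),
      q.right_add x (inf_le_right (a := p.dom) hx) y (inf_le_right (a := p.dom) hy)]
    abel
  right_mul x hx r := by
    rw [p.right_mul x (inf_le_left (a := p.dom) hx), q.right_mul x (inf_le_right (a := p.dom) hx),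
      mul_add]
  compat x hx y hy := by
    rw [add_mul, mul_add, p.compat x (inf_le_left (a := p.dom) hx) y (inf_le_left (a := p.dom) hy),
      q.compat x (inf_le_right (a := p.dom) hx) y (inf_le_right (a := p.dom) hy)]

/-- The product `pq`: `x ↦ p (q x)` and `x ↦ (x p) q`, on the ideal `q.dom * p.dom`, which
`q.left` maps into `p.dom` and `p.right` maps into `q.dom`. -/
def mul (p q : QuotientRep R) : QuotientRep R where
  dom := idealMul q.dom p.dom
  dom_ne_bot := idealMul_ne_bot q.dom_ne_bot p.dom_ne_bot
  left x := p.left (q.left x)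
  right x := q.right (p.right x)
  left_add x hx y hy := by
    rw [q.left_add x (idealMul_le_left hx) y (idealMul_le_left hy),
      p.left_add _ (q.left_mem le_rfl hx) _ (q.left_mem le_rfl hy)]
  left_mul x hx r := by
    rw [q.left_mul x (idealMul_le_left hx), p.left_mul _ (q.left_mem le_rfl hx)]
  right_add x hx y hy := by
    rw [p.right_add x (idealMul_le_right hx) y (idealMul_le_right hy),
      q.right_add _ (p.right_mem le_rfl hx) _ (p.right_mem le_rfl hy)]
  right_mul x hx r := by
    rw [p.right_mul x (idealMul_le_right hx), q.right_mul _ (p.right_mem le_rfl hx)]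
  compat x hx y hy := by
    rw [q.compat _ (p.right_mem le_rfl hx) y (idealMul_le_left hy),
      p.compat x (idealMul_le_right hx) _ (q.left_mem le_rfl hy)]

theorem neg_congr {p p' : QuotientRep R} (h : p ≈ p') : neg p ≈ neg p' := by
  obtain ⟨J, h0, h1, h2, h⟩ := h
  exact ⟨J, h0, h1, h2, fun x hx => ⟨congrArg Neg.neg (h x hx).1, congrArg Neg.neg (h x hx).2⟩⟩

theorem add_congr {p p' q q' : QuotientRep R} (h : p ≈ p') (k : q ≈ q') :
    add p q ≈ add p' q' := by
  obtain ⟨J, h0, h1, h2, h⟩ := h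
  obtain ⟨K, k0, k1, k2, k⟩ := k
  refine ⟨J ⊓ K, inf_ne_bot h0 k0, inf_le_inf h1 k1, inf_le_inf h2 k2, fun x hx => ?_⟩
  have hJ : x ∈ J := (inf_le_left : J ⊓ K ≤ J) hx
  have hK : x ∈ K := (inf_le_right : J ⊓ K ≤ K) hx
  exact ⟨congrArg₂ (· + ·) (h x hJ).1 (k x hK).1, congrArg₂ (· + ·) (h x hJ).2 (k x hK).2⟩

theorem mul_congr {p p' q q' : QuotientRep R} (h : p ≈ p') (k : q ≈ q') :
    mul p q ≈ mul p' q' := by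
  obtain ⟨J, h0, h1, h2, h⟩ := h
  obtain ⟨K, k0, k1, k2, k⟩ := k
  refine ⟨idealMul K J, idealMul_ne_bot k0 h0, idealMul_mono k1 h1, idealMul_mono k2 h2,
    fun x hx => ⟨?_, ?_⟩⟩
  · change p.left (q.left x) = p'.left (q'.left x)
    rw [← (k x (idealMul_le_left hx)).1, (h _ (q.left_mem k1 hx)).1]
  · change q.right (p.right x) = q'.right (p'.right x)
    rw [← (h x (idealMul_le_right hx)).2, (k _ (p.right_mem h1 hx)).2]

end QuotientRep

/-- The Martindale symmetric ring of quotients `Q_s(R)` of a prime ring `R`. -/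
def SymmetricQuotient (R : Type u) [NonUnitalRing R] [IsPrimeRing R] : Type u :=
  Quotient (QuotientRep.setoid R)

namespace SymmetricQuotient

open QuotientRep

variable {R : Type u} [NonUnitalRing R] [IsPrimeRing R]

instance : Zero (SymmetricQuotient R) := ⟨Quotient.mk _ (ofElem 0)⟩
instance : One (SymmetricQuotient R) := ⟨Quotient.mk _ (one R)⟩
instance : Neg (SymmetricQuotient R) := ⟨Quotient.map neg fun _ _ h => neg_congr h⟩
instance : Add (SymmetricQuotient R) :=
  ⟨Quotient.map₂ add fun _ _ h _ _ k => add_congr h k⟩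
instance : Mul (SymmetricQuotient R) :=
  ⟨Quotient.map₂ mul fun _ _ h _ _ k => mul_congr h k⟩

instance : Ring (SymmetricQuotient R) where
  add_assoc := by
    rintro ⟨p⟩ ⟨q⟩ ⟨r⟩
    exact Quotient.sound (equiv_of_agree fun x _ _ => ⟨add_assoc _ _ _, add_assoc _ _ _⟩)
  zero_add := by
    rintro ⟨p⟩
    exact Quotient.sound (equiv_of_agree fun x _ _ => by simp [add, ofElem])
  add_zero := by
    rintro ⟨p⟩
    exact Quotient.sound (equiv_of_agree fun x _ _ => by simp [add, ofElem])
  add_comm := by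
    rintro ⟨p⟩ ⟨q⟩
    exact Quotient.sound (equiv_of_agree fun x _ _ => ⟨add_comm _ _, add_comm _ _⟩)
  neg_add_cancel := by
    rintro ⟨p⟩
    exact Quotient.sound (equiv_of_agree fun x _ _ => by simp [add, neg, ofElem])
  mul_assoc := by
    rintro ⟨p⟩ ⟨q⟩ ⟨r⟩
    exact Quotient.sound (equiv_of_agree fun x _ _ => ⟨rfl, rfl⟩)
  one_mul := by
    rintro ⟨p⟩
    exact Quotient.sound (equiv_of_agree fun x _ _ => ⟨rfl, rfl⟩)
  mul_one := by
    rintro ⟨p⟩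
    exact Quotient.sound (equiv_of_agree fun x _ _ => ⟨rfl, rfl⟩)
  zero_mul := by
    rintro ⟨p⟩
    exact Quotient.sound (equiv_of_agree fun x _ _ => by simp [mul, ofElem, right_zero])
  mul_zero := by
    rintro ⟨p⟩
    exact Quotient.sound (equiv_of_agree fun x _ _ => by simp [mul, ofElem, left_zero])
  left_distrib := by
    rintro ⟨p⟩ ⟨q⟩ ⟨r⟩
    refine Quotient.sound (equiv_of_agree fun x _ hx => ⟨?_, rfl⟩)
    have h1 : x ∈ idealMul q.dom p.dom := (inf_le_left : (mul p q).dom ⊓ (mul p r).dom ≤ _) hx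
    have h2 : x ∈ idealMul r.dom p.dom := (inf_le_right : (mul p q).dom ⊓ (mul p r).dom ≤ _) hx
    exact p.left_add _ (q.left_mem le_rfl h1) _ (r.left_mem le_rfl h2)
  right_distrib := by
    rintro ⟨p⟩ ⟨q⟩ ⟨r⟩
    refine Quotient.sound (equiv_of_agree fun x _ hx => ⟨rfl, ?_⟩)
    have h1 : x ∈ idealMul r.dom p.dom := (inf_le_left : (mul p r).dom ⊓ (mul q r).dom ≤ _) hx
    have h2 : x ∈ idealMul r.dom q.dom := (inf_le_right : (mul p r).dom ⊓ (mul q r).dom ≤ _) hx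
    exact r.right_add _ (p.right_mem le_rfl h1) _ (q.right_mem le_rfl h2)
  nsmul := nsmulRec
  zsmul := zsmulRec

end SymmetricQuotient

section Extended

variable (R : Type u) [NonUnitalRing R] [IsPrimeRing R]

/-- The canonical embedding of `R` into `Q_s(R)`. -/
def toQuotient : R →ₙ+* SymmetricQuotient R where
  toFun r := Quotient.mk _ (QuotientRep.ofElem r)
  map_zero' := rfl
  map_add' a b := Quotient.sound (QuotientRep.equiv_of_agree fun x _ _ =>
    ⟨add_mul a b x, mul_add x a b⟩)
  map_mul' a b := Quotient.sound (QuotientRep.equiv_of_agree fun x _ _ =>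
    ⟨mul_assoc a b x, (mul_assoc x a b).symm⟩)

/-- The extended centroid `C` of `R`: the center of `Q_s(R)`. -/
abbrev ExtendedCentroid : Subring (SymmetricQuotient R) :=
  Subring.center (SymmetricQuotient R)

variable {R}

/-- `AC` for a subset `A` of `R`: the `C`-linear span of `A` inside `Q_s(R)`. -/
def centralSpan (A : Set R) : Submodule (ExtendedCentroid R) (SymmetricQuotient R) :=
  Submodule.span (ExtendedCentroid R) (toQuotient R '' A)

variable (R)

/-- A prime ring `R` is exceptional if `char R = 2` and `dim_C RC = 4`. The characteristic of a
ring which need not be unital is the exponent of its additive group (`0` if there is none). -/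
def IsExceptional : Prop :=
  AddMonoid.exponent R = 2 ∧
    Module.finrank (ExtendedCentroid R) (centralSpan (Set.univ : Set R)) = 4

end Extended

end PrimeLie

/-!
Work inside `Q_s(R)`, with the `C`-spans of `R`, `K` and `L`. If `[a, [b, R]] = 0` with `b ∉ C`,
then Martindale's lemma gives `a = λb + μ` with `2λ = 0`. Hence, if `K` and `L` commute and
`b ∈ L ∖ C`, both lie in `Cb + C`, the characteristic is two, and `[b, [b, R]] = [b², R] = 0` shows
`b² ∈ C`. The map `ad b` sends `RC` onto `Cb + C` and has kernel `Cb + C` on `RC`, so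
`dim RC = 2 + 2`.

The powers `K^m` and `L^n` span noncentral Lie ideals as well, so if they commute, then
`K^m ⊆ Cb + C` for some such `b`. Either `K` centralizes `b`, and then `K ⊆ Cb + C`; or `KC`
contains a nonzero `[b, v] ∈ Cb + C`, hence it contains `1`, and `K ⊆ (KC)^m ⊆ Cb + C`. The same
holds for `L`, and `Cb + C` is commutative.
-/

namespace PrimeLie

section CommRing

variable {F A : Type*} [CommRing F] [Ring A] [Algebra F A]

attribute [local instance] LieRing.ofAssociativeRing

theorem lie_mul_eq (b x y : A) : ⁅b, x * y⁆ = ⁅b, x⁆ * y + x * ⁅b, y⁆ := by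
  simp only [Ring.lie_def]
  noncomm_ring

theorem lie_lie_self_eq_of_charTwo [CharP A 2] (b x : A) : ⁅b, ⁅b, x⁆⁆ = ⁅b * b, x⁆ := by
  have h : b * x * b + b * x * b = 0 := CharTwo.add_self_eq_zero _
  calc ⁅b, ⁅b, x⁆⁆ = ⁅b * b, x⁆ + (x * b * b + x * b * b) - (b * x * b + b * x * b) := by
        simp only [Ring.lie_def]
        noncomm_ring
    _ = ⁅b * b, x⁆ := by rw [h, CharTwo.add_self_eq_zero, add_zero, sub_zero]

variable (F) in
/-- The subspace `Fb + F` of an `F`-algebra, the form which two commuting noncentral Lie ideals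
are forced to have. -/
def affineSpan (b : A) : Submodule F A :=
  Submodule.span F {b, 1}

theorem mem_affineSpan {b q : A} :
    q ∈ affineSpan F b ↔ ∃ l k : F, l • b + k • (1 : A) = q :=
  Submodule.mem_span_pair

theorem self_mem_affineSpan (b : A) : b ∈ affineSpan F b :=
  Submodule.subset_span (Set.mem_insert b _)

theorem one_le_affineSpan (b : A) : 1 ≤ affineSpan F b :=
  Submodule.one_le.2 (Submodule.subset_span (Set.mem_insert_of_mem b rfl))

theorem smul_one_mem_one (k : F) : k • (1 : A) ∈ (1 : Submodule F A) :=
  Submodule.smul_mem _ k (Submodule.one_le.1 le_rfl)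

theorem mem_one_iff_exists_smul {q : A} : q ∈ (1 : Submodule F A) ↔ ∃ k : F, k • (1 : A) = q := by
  simp only [Submodule.mem_one, Algebra.algebraMap_eq_smul_one]

theorem commute_of_mem_affineSpan {b p q : A} (hp : p ∈ affineSpan F b)
    (hq : q ∈ affineSpan F b) : Commute p q := by
  obtain ⟨l, k, rfl⟩ := mem_affineSpan.1 hp
  obtain ⟨l', k', rfl⟩ := mem_affineSpan.1 hq
  have hb : Commute b (l' • b + k' • (1 : A)) :=
    ((Commute.refl b).smul_right l').add_right ((Commute.one_right b).smul_right k')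
  exact (hb.smul_left l).add_left ((Commute.one_left _).smul_left k)

theorem affineSpan_le_iff {b : A} {V : Submodule F A} : affineSpan F b ≤ V ↔ b ∈ V ∧ 1 ≤ V := by
  rw [affineSpan, Submodule.span_le, Set.insert_subset_iff, Set.singleton_subset_iff,
    Submodule.one_le, SetLike.mem_coe, SetLike.mem_coe]

theorem affineSpan_mul_le {b : A} (hb : b * b ∈ (1 : Submodule F A)) :
    affineSpan F b * affineSpan F b ≤ affineSpan F b := by
  have hb' : b * b ∈ affineSpan F b := one_le_affineSpan b hb
  have h1 : (1 : A) ∈ affineSpan F b := Submodule.one_le.1 (one_le_affineSpan b)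
  rw [affineSpan, Submodule.span_mul_span, Submodule.span_le]
  rintro _ ⟨p, rfl | rfl, q, rfl | rfl, rfl⟩ <;>
    simp only [mul_one, one_mul, SetLike.mem_coe] <;>
    first | exact hb' | exact self_mem_affineSpan _ | exact h1

theorem smul_add_smul_one_mul_self [CharP A 2] (b : A) (l k : F) :
    (l • b + k • (1 : A)) * (l • b + k • (1 : A)) = (l * l) • (b * b) + (k * k) • (1 : A) := by
  have h : (l * k) • b + (l * k) • b = 0 := CharTwo.add_self_eq_zero _
  simp only [mul_add, add_mul, smul_mul_smul_comm, mul_one, one_mul, mul_comm k l]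
  rw [add_assoc, ← add_assoc ((l * k) • b), h, zero_add]

theorem mul_self_mem_one_of_mem_affineSpan [CharP A 2] {b v : A}
    (hb : b * b ∈ (1 : Submodule F A)) (hv : v ∈ affineSpan F b) :
    v * v ∈ (1 : Submodule F A) := by
  obtain ⟨l, k, rfl⟩ := mem_affineSpan.1 hv
  rw [smul_add_smul_one_mul_self]
  exact add_mem (Submodule.smul_mem _ _ hb) (smul_one_mem_one _)

theorem commute_pow_left {V : Submodule F A} {y : A} (h : ∀ v ∈ V, Commute v y) (m : ℕ) :
    ∀ v ∈ V ^ m, Commute v y := fun v hv => by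
  induction hv using Submodule.pow_induction_on_left' with
  | algebraMap r => exact Algebra.commutes r y
  | add _ _ _ _ _ hv hw => exact hv.add_left hw
  | mem_mul v hv _ _ _ hw => exact (h v hv).mul_left hw

theorem commute_pow_pow {V W : Submodule F A} (h : ∀ v ∈ V, ∀ w ∈ W, Commute v w) (m n : ℕ) :
    ∀ v ∈ V ^ m, ∀ w ∈ W ^ n, Commute v w := fun v hv w hw =>
  commute_pow_left (fun v hv => (commute_pow_left (fun w hw => (h v hv w hw).symm) n w hw).symm)
    m v hv

/-- A subalgebra `S`, not necessarily with unity, of `A` which is prime and satisfies Martindale's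
lemma with coefficients in `A` and scalars in `F`. The case of interest is `S = RC`, `A = Q_s(R)`
and `F = C`. -/
structure IsCentrallyClosed (S : Submodule F A) : Prop where
  mul_le : S * S ≤ S
  eq_zero_or_eq_zero : ∀ p q : A, (∀ x ∈ S, p * x * q = 0) → p = 0 ∨ q = 0
  exists_smul_eq : ∀ a b c : A, a ≠ 0 → (∀ x ∈ S, a * x * c = b * x * a) →
    ∃ l : F, b = l • a ∧ c = l • a

namespace IsCentrallyClosed

variable {S : Submodule F A} (hS : IsCentrallyClosed S)
include hS

theorem mul_mem {x y : A} (hx : x ∈ S) (hy : y ∈ S) : x * y ∈ S :=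
  Submodule.mul_le.1 hS.mul_le x hx y hy

theorem mem_one_of_lie_eq_zero {q : A} (h : ∀ x ∈ S, ⁅q, x⁆ = 0) : q ∈ (1 : Submodule F A) := by
  nontriviality A
  obtain ⟨l, hl, -⟩ := hS.exists_smul_eq 1 q q one_ne_zero fun x hx => by
    rw [one_mul, mul_one, ← sub_eq_zero, ← Ring.lie_def, ← lie_skew, h x hx, neg_zero]
  exact hl ▸ smul_one_mem_one l

theorem exists_lie_ne_zero {b : A} (hb : b ∉ (1 : Submodule F A)) : ∃ x ∈ S, ⁅b, x⁆ ≠ 0 := by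
  by_contra! h
  exact hb (hS.mem_one_of_lie_eq_zero h)

theorem lie_mul_lie_add_lie_mul_lie {a b : A} (h : ∀ x ∈ S, ⁅a, ⁅b, x⁆⁆ = 0) {x y : A}
    (hx : x ∈ S) (hy : y ∈ S) : ⁅a, x⁆ * ⁅b, y⁆ + ⁅b, x⁆ * ⁅a, y⁆ = 0 := by
  have hxy := h _ (hS.mul_mem hx hy)
  rwa [lie_mul_eq, lie_add, lie_mul_eq, lie_mul_eq, h x hx, h y hy, zero_mul, mul_zero, zero_add,
    add_zero, add_comm] at hxy

theorem lie_mul_mul_neg_lie {a b : A} (h : ∀ x ∈ S, ⁅a, ⁅b, x⁆⁆ = 0) {x y z : A} (hx : x ∈ S)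
    (hy : y ∈ S) (hz : z ∈ S) : ⁅b, x⁆ * y * -⁅a, z⁆ = ⁅a, x⁆ * y * ⁅b, z⁆ := by
  have hyz := hS.lie_mul_lie_add_lie_mul_lie h hx (hS.mul_mem hy hz)
  have hy' := hS.lie_mul_lie_add_lie_mul_lie h hx hy
  rw [mul_neg, neg_eq_iff_add_eq_zero, add_comm]
  calc ⁅a, x⁆ * y * ⁅b, z⁆ + ⁅b, x⁆ * y * ⁅a, z⁆
      = ⁅a, x⁆ * ⁅b, y * z⁆ + ⁅b, x⁆ * ⁅a, y * z⁆
          - (⁅a, x⁆ * ⁅b, y⁆ + ⁅b, x⁆ * ⁅a, y⁆) * z := by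
        rw [lie_mul_eq, lie_mul_eq]
        noncomm_ring
    _ = 0 := by rw [hyz, hy', zero_mul, sub_zero]

end IsCentrallyClosed

/-- `V` is a Lie ideal of `S`, and an `F`-subspace rather than only an additive subgroup. -/
structure IsLieIdealIn (S V : Submodule F A) : Prop where
  le : V ≤ S
  lie_mem : ∀ v ∈ V, ∀ x ∈ S, ⁅v, x⁆ ∈ V

namespace IsLieIdealIn

variable {S V W : Submodule F A}

theorem mul (hV : IsLieIdealIn S V) (hW : IsLieIdealIn S W) (hS : S * S ≤ S) :
    IsLieIdealIn S (V * W) where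
  le := (mul_le_mul' hV.le hW.le).trans hS
  lie_mem p hp x hx := by
    induction hp using Submodule.mul_induction_on' with
    | mem_mul_mem v hv w hw =>
      rw [← lie_skew, lie_mul_eq, neg_add, ← neg_mul, ← mul_neg, lie_skew, lie_skew]
      exact add_mem (Submodule.mul_mem_mul (hV.lie_mem v hv x hx) hw)
        (Submodule.mul_mem_mul hv (hW.lie_mem w hw x hx))
    | add p _ q _ hp hq =>
      rw [add_lie]
      exact add_mem hp hq

theorem pow (hV : IsLieIdealIn S V) (hS : S * S ≤ S) {m : ℕ} (hm : 1 ≤ m) :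
    IsLieIdealIn S (V ^ m) := by
  induction m, hm using Nat.le_induction with
  | base => rwa [pow_one]
  | succ m _ ih => exact pow_succ V m ▸ ih.mul hV hS

theorem eq_zero_of_forall_mul_eq_zero (hV : IsLieIdealIn S V) (hS : IsCentrallyClosed S)
    (hV0 : V ≠ ⊥) {w : A} (hw : ∀ v ∈ V, w * v = 0) : w = 0 := by
  obtain ⟨v, hv, hv0⟩ := Submodule.exists_mem_ne_zero_of_ne_bot hV0
  refine (hS.eq_zero_or_eq_zero w v fun x hx => ?_).resolve_right hv0
  have hvx := hw _ (hV.lie_mem v hv x hx)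
  rwa [Ring.lie_def, mul_sub, ← mul_assoc, hw v hv, zero_mul, zero_sub, neg_eq_zero,
    ← mul_assoc] at hvx

theorem pow_ne_bot (hV : IsLieIdealIn S V) (hS : IsCentrallyClosed S) (hV0 : V ≠ ⊥) {m : ℕ}
    (hm : 1 ≤ m) : V ^ m ≠ ⊥ := by
  induction m, hm using Nat.le_induction with
  | base => rwa [pow_one]
  | succ m _ ih =>
    obtain ⟨w, hw, hw0⟩ := Submodule.exists_mem_ne_zero_of_ne_bot ih
    intro h
    refine hw0 (hV.eq_zero_of_forall_mul_eq_zero hS hV0 fun v hv => ?_)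
    rw [← Submodule.mem_bot F, ← h, pow_succ]
    exact Submodule.mul_mem_mul hw hv

theorem lie_lie_eq_zero_of_commute (hW : IsLieIdealIn S W) (h : ∀ v ∈ V, ∀ w ∈ W, Commute v w)
    {a b : A} (ha : a ∈ V) (hb : b ∈ W) : ∀ x ∈ S, ⁅a, ⁅b, x⁆⁆ = 0 := fun x hx =>
  (h a ha _ (hW.lie_mem b hb x hx)).lie_eq

end IsLieIdealIn

end CommRing

section Field

variable {F A : Type*} [Field F] [Ring A] [Algebra F A]

attribute [local instance] LieRing.ofAssociativeRing

theorem affineSpan_eq_of_mem {a b : A} (ha : a ∈ affineSpan F b) (ha1 : a ∉ (1 : Submodule F A)) :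
    affineSpan F a = affineSpan F b := by
  refine le_antisymm (affineSpan_le_iff.2 ⟨ha, one_le_affineSpan b⟩)
    (affineSpan_le_iff.2 ⟨?_, one_le_affineSpan a⟩)
  obtain ⟨l, k, rfl⟩ := mem_affineSpan.1 ha
  have hl : l ≠ 0 := by
    rintro rfl
    exact ha1 (by simpa only [zero_smul, zero_add] using smul_one_mem_one k)
  refine mem_affineSpan.2 ⟨l⁻¹, -(l⁻¹ * k), ?_⟩
  rw [smul_add, inv_smul_smul₀ hl]
  module

theorem rank_affineSpan {b : A} (hb : b ∉ (1 : Submodule F A)) :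
    Module.rank F (affineSpan F b) = 2 := by
  have : Nontrivial A := ⟨b, 0, fun h => hb (h ▸ zero_mem _)⟩
  have hli : LinearIndependent F (![1, b] : Fin 2 → A) := by
    rw [LinearIndependent.pair_iff' one_ne_zero]
    exact fun k hk => hb (hk ▸ smul_one_mem_one k)
  have hspan : affineSpan F b = Submodule.span F (Set.range ![1, b]) := by
    rw [affineSpan, Matrix.range_cons_cons_empty, Set.pair_comm]
  rw [hspan, rank_eq_card_basis (Module.Basis.span hli), Fintype.card_fin]
  exact Nat.cast_two

theorem mul_eq_zero_of_mem_affineSpan [CharP A 2] {b v w : A} (hv : v ∈ affineSpan F b)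
    (hw : w ∈ affineSpan F b) (hv2 : v * v = 0) (hw2 : w * w = 0) : v * w = 0 := by
  have : Nontrivial A := CharP.nontrivial_of_char_ne_one (R := A) (v := 2) (by decide)
  by_cases hv1 : v ∈ (1 : Submodule F A)
  · obtain ⟨k, rfl⟩ := mem_one_iff_exists_smul.1 hv1
    have hk : k * k = 0 := by simpa [smul_mul_smul_comm] using hv2
    rw [mul_self_eq_zero.1 hk, zero_smul, zero_mul]
  · rw [← affineSpan_eq_of_mem hv hv1] at hw
    obtain ⟨l, k, rfl⟩ := mem_affineSpan.1 hw
    have hk : k * k = 0 := by simpa [smul_add_smul_one_mul_self, hv2] using hw2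
    rw [mul_self_eq_zero.1 hk, zero_smul, add_zero, mul_smul_comm, hv2, smul_zero]

/-- Fixing `w ∈ V ^ m` and `x ∈ V` with `w x` a nonzero scalar, each `y ∈ V` satisfies
`(w x) y = y (w x) = (y w) x`, where `y w` is a scalar. -/
theorem exists_le_span_singleton_of_pow_le_one {V : Submodule F A} {m : ℕ}
    (h1 : V ^ (m + 1) ≤ 1) (h0 : V ^ (m + 1) ≠ ⊥) : ∃ x, V ≤ Submodule.span F {x} := by
  obtain ⟨w, hw, x, hx, hwx⟩ : ∃ w ∈ V ^ m, ∃ x ∈ V, w * x ≠ 0 := by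
    by_contra! h
    exact h0 (eq_bot_iff.2 (by rw [pow_succ]; exact Submodule.mul_le.2 h))
  have scalar_of_mem {q : A} (hq : q ∈ V ^ (m + 1)) : ∃ k : F, k • (1 : A) = q :=
    mem_one_iff_exists_smul.1 (h1 hq)
  obtain ⟨l, hl⟩ := scalar_of_mem (pow_succ V m ▸ Submodule.mul_mem_mul hw hx)
  have hl0 : l ≠ 0 := by
    rintro rfl
    exact hwx (by rw [← hl, zero_smul])
  refine ⟨x, fun y hy => Submodule.mem_span_singleton.2 ?_⟩
  obtain ⟨k, hk⟩ := scalar_of_mem (pow_succ' V m ▸ Submodule.mul_mem_mul hy hw)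
  have hxy : l • y = k • x := by
    calc l • y = y * (w * x) := by rw [← hl, mul_smul_comm, mul_one]
      _ = k • x := by rw [← mul_assoc, ← hk, smul_mul_assoc, one_mul]
  exact ⟨l⁻¹ * k, by rw [mul_smul, ← hxy, inv_smul_smul₀ hl0]⟩

namespace IsCentrallyClosed

variable {S : Submodule F A} (hS : IsCentrallyClosed S)
include hS

theorem exists_eq_smul_add_smul_one {a b : A} (hb : b ∉ (1 : Submodule F A))
    (h : ∀ x ∈ S, ⁅a, ⁅b, x⁆⁆ = 0) : ∃ l k : F, 2 * l = 0 ∧ l • b + k • (1 : A) = a := by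
  obtain ⟨x, hx, hbx⟩ := hS.exists_lie_ne_zero hb
  obtain ⟨l, hl, hl'⟩ := hS.exists_smul_eq _ _ _ hbx fun y hy => hS.lie_mul_mul_neg_lie h hx hy hx
  have h2l : 2 * l = 0 := by
    refine (smul_eq_zero.1 ?_).resolve_right hbx
    calc (2 * l) • ⁅b, x⁆ = l • ⁅b, x⁆ + l • ⁅b, x⁆ := by rw [two_mul, add_smul]
      _ = ⁅a, x⁆ + -⁅a, x⁆ := congrArg₂ (· + ·) hl.symm hl'.symm
      _ = 0 := add_neg_cancel _
  have hab : a - l • b ∈ (1 : Submodule F A) := hS.mem_one_of_lie_eq_zero fun z hz => by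
    refine (hS.eq_zero_or_eq_zero _ _ fun y hy => ?_).resolve_left hbx
    calc ⁅b, x⁆ * y * ⁅a - l • b, z⁆
        = -(⁅b, x⁆ * y * -⁅a, z⁆) - l • (⁅b, x⁆ * y * ⁅b, z⁆) := by
          rw [sub_lie, smul_lie, mul_sub, mul_neg, neg_neg, mul_smul_comm]
      _ = -((2 * l) • (⁅b, x⁆ * y * ⁅b, z⁆)) := by
          rw [hS.lie_mul_mul_neg_lie h hx hy hz, hl, smul_mul_assoc, smul_mul_assoc]
          module
      _ = 0 := by rw [h2l, zero_smul, neg_zero]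
  obtain ⟨k, hk⟩ := mem_one_iff_exists_smul.1 hab
  exact ⟨l, k, h2l, by rw [hk, add_sub_cancel]⟩

theorem mem_affineSpan_of_lie_lie_eq_zero {a b : A} (hb : b ∉ (1 : Submodule F A))
    (h : ∀ x ∈ S, ⁅a, ⁅b, x⁆⁆ = 0) : a ∈ affineSpan F b := by
  obtain ⟨l, k, -, hlk⟩ := hS.exists_eq_smul_add_smul_one hb h
  exact mem_affineSpan.2 ⟨l, k, hlk⟩

end IsCentrallyClosed

/-- A noncentral element `b` of `S` with `b² ∈ F` and `[b, S] ⊆ Fb + F`, in characteristic two.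
If `F[b]` is a field, then it is a purely inseparable quadratic extension of `F`. -/
structure IsInseparable (S : Submodule F A) (b : A) : Prop where
  char_two : CharP A 2
  mem : b ∈ S
  notMem_one : b ∉ (1 : Submodule F A)
  mul_self_mem_one : b * b ∈ (1 : Submodule F A)
  lie_mem : ∀ x ∈ S, ⁅b, x⁆ ∈ affineSpan F b

namespace IsInseparable

variable {S : Submodule F A} {b : A} (hb : IsInseparable S b) (hS : IsCentrallyClosed S)
include hb

theorem mul_mem {p q : A} (hp : p ∈ affineSpan F b) (hq : q ∈ affineSpan F b) :
    p * q ∈ affineSpan F b :=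
  affineSpan_mul_le hb.mul_self_mem_one (Submodule.mul_mem_mul hp hq)

include hS

theorem lie_mem_of_mem {x : A} (hx : x ∈ S) : ⁅b, x⁆ ∈ S := by
  rw [Ring.lie_def]
  exact sub_mem (hS.mul_mem hb.mem hx) (hS.mul_mem hx hb.mem)

theorem exists_lie_mul_self_ne_zero : ∃ x ∈ S, ⁅b, x⁆ * ⁅b, x⁆ ≠ 0 := by
  have := hb.char_two
  by_contra! h
  obtain ⟨y, hy, hby⟩ := hS.exists_lie_ne_zero hb.notMem_one
  have mul_eq_zero {x z : A} (hx : x ∈ S) (hz : z ∈ S) : ⁅b, x⁆ * ⁅b, z⁆ = 0 :=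
    mul_eq_zero_of_mem_affineSpan (hb.lie_mem x hx) (hb.lie_mem z hz) (h x hx) (h z hz)
  have h_sandwich : ∀ x ∈ S, ⁅b, y⁆ * x * ⁅b, y⁆ = 0 := fun x hx => by
    have hxy := mul_eq_zero hy (hS.mul_mem hx hy)
    rwa [lie_mul_eq, mul_add, ← mul_assoc, mul_eq_zero hy hx, zero_mul, zero_add,
      ← mul_assoc] at hxy
  exact (hS.eq_zero_or_eq_zero _ _ h_sandwich).elim hby hby

theorem exists_lie_mul_lie_eq_one : ∃ x ∈ S, ∃ y ∈ S, ⁅b, x⁆ * ⁅b, y⁆ = 1 := by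
  have := hb.char_two
  obtain ⟨x, hx, hx0⟩ := hb.exists_lie_mul_self_ne_zero hS
  obtain ⟨k, hk⟩ := mem_one_iff_exists_smul.1
    (mul_self_mem_one_of_mem_affineSpan hb.mul_self_mem_one (hb.lie_mem x hx))
  have hk0 : k ≠ 0 := by
    rintro rfl
    exact hx0 (by rw [← hk, zero_smul])
  refine ⟨x, hx, k⁻¹ • x, S.smul_mem _ hx, ?_⟩
  rw [lie_smul k⁻¹ b x, mul_smul_comm, ← hk, inv_smul_smul₀ hk0]

theorem affineSpan_le : affineSpan F b ≤ S := by
  obtain ⟨x, hx, y, hy, hxy⟩ := hb.exists_lie_mul_lie_eq_one hS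
  refine affineSpan_le_iff.2 ⟨hb.mem, Submodule.one_le.2 ?_⟩
  exact hxy ▸ hS.mul_mem (hb.lie_mem_of_mem hS hx) (hb.lie_mem_of_mem hS hy)

theorem mem_affineSpan_of_commute {s : A} (hs : s ∈ S) (h : Commute b s) :
    s ∈ affineSpan F b := by
  obtain ⟨x, hx, y, hy, hxy⟩ := hb.exists_lie_mul_lie_eq_one hS
  have hs_eq : s = ⁅b, s * x⁆ * ⁅b, y⁆ := by
    rw [lie_mul_eq, h.lie_eq, zero_mul, zero_add, mul_assoc, hxy, mul_one]
  rw [hs_eq]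
  exact hb.mul_mem (hb.lie_mem _ (hS.mul_mem hs hx)) (hb.lie_mem y hy)

theorem exists_lie_eq {t : A} (ht : t ∈ affineSpan F b) : ∃ s ∈ S, ⁅b, s⁆ = t := by
  obtain ⟨x, hx, y, hy, hxy⟩ := hb.exists_lie_mul_lie_eq_one hS
  have hc : t * ⁅b, x⁆ ∈ affineSpan F b := hb.mul_mem ht (hb.lie_mem x hx)
  refine ⟨t * ⁅b, x⁆ * y, hS.mul_mem (hb.affineSpan_le hS hc) hy, ?_⟩
  rw [lie_mul_eq, (commute_of_mem_affineSpan (self_mem_affineSpan b) hc).lie_eq, zero_mul, zero_add,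
    mul_assoc, hxy, mul_one]

theorem map_ad_eq_affineSpan : S.map (LieAlgebra.ad F A b : A →ₗ[F] A) = affineSpan F b :=
  le_antisymm (Submodule.map_le_iff_le_comap.2 hb.lie_mem) fun _ ht => hb.exists_lie_eq hS ht

theorem ker_ad_domRestrict_eq :
    LinearMap.ker ((LieAlgebra.ad F A b : A →ₗ[F] A).domRestrict S) =
      (affineSpan F b).comap S.subtype := by
  ext s
  rw [LinearMap.mem_ker, LinearMap.domRestrict_apply, LieAlgebra.ad_apply, Submodule.mem_comap,
    Submodule.subtype_apply, ← commute_iff_lie_eq]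
  exact ⟨hb.mem_affineSpan_of_commute hS s.2, commute_of_mem_affineSpan (self_mem_affineSpan b)⟩

theorem finrank_eq_four : Module.finrank F S = 4 := by
  have h_ker := (Submodule.comapSubtypeEquivOfLe (hb.affineSpan_le hS)).rank_eq
  refine Module.finrank_eq_of_rank_eq ?_
  rw [← LinearMap.rank_range_add_rank_ker ((LieAlgebra.ad F A b : A →ₗ[F] A).domRestrict S),
    LinearMap.range_domRestrict, hb.map_ad_eq_affineSpan hS, hb.ker_ad_domRestrict_eq hS, h_ker,
    rank_affineSpan hb.notMem_one]
  norm_num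

theorem of_mem_affineSpan {u : A} (hu : u ∈ affineSpan F b) (hu1 : u ∉ (1 : Submodule F A)) :
    IsInseparable S u where
  char_two := hb.char_two
  mem := hb.affineSpan_le hS hu
  notMem_one := hu1
  mul_self_mem_one :=
    have := hb.char_two
    mul_self_mem_one_of_mem_affineSpan hb.mul_self_mem_one hu
  lie_mem x hx := by
    rw [affineSpan_eq_of_mem hu hu1]
    obtain ⟨l, k, rfl⟩ := mem_affineSpan.1 hu
    rw [add_lie, smul_lie, smul_lie, (Commute.one_left x).lie_eq, smul_zero, add_zero]
    exact Submodule.smul_mem _ l (hb.lie_mem x hx)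

variable {V : Submodule F A}

theorem affineSpan_le_of_mem (hV : IsLieIdealIn S V) {u : A} (huV : u ∈ V)
    (hu : u ∈ affineSpan F b) (hu1 : u ∉ (1 : Submodule F A)) : affineSpan F b ≤ V := by
  rw [← affineSpan_eq_of_mem hu hu1]
  intro t ht
  obtain ⟨s, hs, rfl⟩ := (hb.of_mem_affineSpan hS hu hu1).exists_lie_eq hS ht
  exact hV.lie_mem u huV s hs

theorem eq_affineSpan (hV : IsLieIdealIn S V) (hVb : V ≤ affineSpan F b) (hV1 : ¬ V ≤ 1) :
    V = affineSpan F b := by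
  obtain ⟨u, hu, hu1⟩ := SetLike.not_le_iff_exists.1 hV1
  exact le_antisymm hVb (hb.affineSpan_le_of_mem hS hV hu (hVb hu) hu1)

theorem le_affineSpan_of_pow_le (hV : IsLieIdealIn S V) {m : ℕ} (hm : 1 ≤ m)
    (h : V ^ m ≤ affineSpan F b) : V ≤ affineSpan F b := by
  by_cases h_comm : ∀ v ∈ V, Commute b v
  · exact fun v hv => hb.mem_affineSpan_of_commute hS (hV.le hv) (h_comm v hv)
  push Not at h_comm
  obtain ⟨v, hv, hbv⟩ := h_comm
  have huV : ⁅b, v⁆ ∈ V := by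
    rw [← lie_skew]
    exact neg_mem (hV.lie_mem v hv b hb.mem)
  have h1V : 1 ≤ V := by
    by_cases hu1 : ⁅b, v⁆ ∈ (1 : Submodule F A)
    · obtain ⟨k, hk⟩ := mem_one_iff_exists_smul.1 hu1
      have hk0 : k ≠ 0 := by
        rintro rfl
        exact hbv (commute_iff_lie_eq.2 (by rw [← hk, zero_smul]))
      rwa [Submodule.one_le, ← inv_smul_smul₀ hk0 (1 : A), hk, V.smul_mem_iff (inv_ne_zero hk0)]
    · exact (one_le_affineSpan b).trans
        (hb.affineSpan_le_of_mem hS hV huV (hb.lie_mem v (hV.le hv)) hu1)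
  exact (le_self_pow h1V (Nat.one_le_iff_ne_zero.1 hm)).trans h

end IsInseparable

namespace IsCentrallyClosed

variable {S V W : Submodule F A} (hS : IsCentrallyClosed S)
include hS

theorem charP_two_of_lie_lie_eq_zero {a b : A} (ha : a ∉ (1 : Submodule F A))
    (hb : b ∉ (1 : Submodule F A)) (h : ∀ x ∈ S, ⁅a, ⁅b, x⁆⁆ = 0) : CharP A 2 := by
  obtain ⟨l, k, hl, rfl⟩ := hS.exists_eq_smul_add_smul_one hb h
  have hl0 : l ≠ 0 := by
    rintro rfl
    exact ha (by simpa only [zero_smul, zero_add] using smul_one_mem_one k)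
  have h2 : (2 : F) = 0 := (mul_eq_zero.1 hl).resolve_right hl0
  refine CharTwo.of_one_ne_zero_of_two_eq_zero (fun h1 => ha ?_) ?_
  · rw [← one_mul (_ + _), h1, zero_mul]
    exact zero_mem _
  · rw [← map_ofNat (algebraMap F A) 2, h2, map_zero]

theorem le_affineSpan_of_commute (hW : IsLieIdealIn S W) (h : ∀ v ∈ V, ∀ w ∈ W, Commute v w)
    {b : A} (hb : b ∈ W) (hb1 : b ∉ (1 : Submodule F A)) : V ≤ affineSpan F b := fun _ ha =>
  hS.mem_affineSpan_of_lie_lie_eq_zero hb1 (hW.lie_lie_eq_zero_of_commute h ha hb)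

theorem le_affineSpan_of_commute_self (hV : IsLieIdealIn S V) (hW : IsLieIdealIn S W)
    (hV1 : ¬ V ≤ 1) (h : ∀ v ∈ V, ∀ w ∈ W, Commute v w) {b : A} (hb : b ∈ W)
    (hb1 : b ∉ (1 : Submodule F A)) : W ≤ affineSpan F b := by
  obtain ⟨a, ha, ha1⟩ := SetLike.not_le_iff_exists.1 hV1
  rw [← affineSpan_eq_of_mem (hS.le_affineSpan_of_commute hW h hb hb1 ha) ha1]
  exact hS.le_affineSpan_of_commute hV (fun w hw v hv => (h v hv w hw).symm) ha ha1

theorem isInseparable_of_commute (hV : IsLieIdealIn S V) (hW : IsLieIdealIn S W)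
    (hV1 : ¬ V ≤ 1) (h : ∀ v ∈ V, ∀ w ∈ W, Commute v w) {b : A} (hb : b ∈ W)
    (hb1 : b ∉ (1 : Submodule F A)) : IsInseparable S b := by
  obtain ⟨a, ha, ha1⟩ := SetLike.not_le_iff_exists.1 hV1
  have h_char : CharP A 2 := hS.charP_two_of_lie_lie_eq_zero ha1 hb1
    (hW.lie_lie_eq_zero_of_commute h ha hb)
  have h_lie : ∀ x ∈ S, ⁅b, x⁆ ∈ affineSpan F b := fun x hx =>
    hS.le_affineSpan_of_commute_self hV hW hV1 h hb hb1 (hW.lie_mem b hb x hx)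
  refine ⟨h_char, hW.le hb, hb1, hS.mem_one_of_lie_eq_zero fun x hx => ?_, h_lie⟩
  rw [← lie_lie_self_eq_of_charTwo]
  exact (commute_of_mem_affineSpan (self_mem_affineSpan b) (h_lie x hx)).lie_eq

theorem not_pow_le_one (hV : IsLieIdealIn S V) (hV1 : ¬ V ≤ 1) {m : ℕ} (hm : 1 ≤ m) :
    ¬ V ^ m ≤ 1 := by
  intro h
  have hV0 : V ≠ ⊥ := fun hV0 => hV1 (hV0 ▸ bot_le)
  obtain ⟨k, rfl⟩ := Nat.exists_eq_add_of_le' hm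
  obtain ⟨x, hVx⟩ := exists_le_span_singleton_of_pow_le_one h (hV.pow_ne_bot hS hV0 hm)
  have h_comm : ∀ v ∈ V, ∀ w ∈ V, Commute v w := fun v hv w hw => by
    obtain ⟨c, rfl⟩ := Submodule.mem_span_singleton.1 (hVx hv)
    obtain ⟨d, rfl⟩ := Submodule.mem_span_singleton.1 (hVx hw)
    exact ((Commute.refl x).smul_left c).smul_right d
  obtain ⟨b, hb, hb1⟩ := SetLike.not_le_iff_exists.1 hV1
  have hV_eq := (hS.isInseparable_of_commute hV hV hV1 h_comm hb hb1).eq_affineSpan hS hV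
    (hS.le_affineSpan_of_commute hV h_comm hb hb1) hV1
  have h1V : 1 ≤ V := hV_eq ▸ one_le_affineSpan b
  exact hV1 ((le_self_pow h1V k.succ_ne_zero).trans h)

theorem commute_of_commute_pow (hV : IsLieIdealIn S V) (hW : IsLieIdealIn S W) (hV1 : ¬ V ≤ 1)
    (hW1 : ¬ W ≤ 1) {m n : ℕ} (hm : 1 ≤ m) (hn : 1 ≤ n)
    (h : ∀ v ∈ V ^ m, ∀ w ∈ W ^ n, Commute v w) : ∀ v ∈ V, ∀ w ∈ W, Commute v w := by
  have hVm := hV.pow hS.mul_le hm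
  have hWn := hW.pow hS.mul_le hn
  have hVm1 := hS.not_pow_le_one hV hV1 hm
  obtain ⟨b, hb, hb1⟩ := SetLike.not_le_iff_exists.1 (hS.not_pow_le_one hW hW1 hn)
  have hbS := hS.isInseparable_of_commute hVm hWn hVm1 h hb hb1
  have hVb := hbS.le_affineSpan_of_pow_le hS hV hm (hS.le_affineSpan_of_commute hWn h hb hb1)
  have hWb := hbS.le_affineSpan_of_pow_le hS hW hn
    (hS.le_affineSpan_of_commute_self hVm hWn hVm1 h hb hb1)
  exact fun v hv w hw => commute_of_mem_affineSpan (hVb hv) (hWb hw)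

end IsCentrallyClosed

end Field

section Quotient

variable {R : Type*} [NonUnitalRing R] [IsPrimeRing R]

theorem eq_zero_of_forall_mul_right {a : R} {J : TwoSidedIdeal R} (hJ : J ≠ ⊥)
    (h : ∀ x ∈ J, a * x = 0) : a = 0 := by
  obtain ⟨y, hy, hy0⟩ := exists_mem_ne_zero hJ
  refine (IsPrimeRing.eq_zero_or_eq_zero a y fun r => ?_).resolve_right hy0
  rw [mul_assoc]
  exact h _ (J.mul_mem_left _ _ hy)

theorem eq_zero_of_forall_mul_left {a : R} {J : TwoSidedIdeal R} (hJ : J ≠ ⊥)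
    (h : ∀ x ∈ J, x * a = 0) : a = 0 := by
  obtain ⟨y, hy, hy0⟩ := exists_mem_ne_zero hJ
  exact (IsPrimeRing.eq_zero_or_eq_zero y a fun r => h _ (J.mul_mem_right _ _ hy)).resolve_left hy0

/-- The element of `Q_s(R)` with a given representative. -/
def SymmetricQuotient.mk (p : QuotientRep R) : SymmetricQuotient R :=
  Quotient.mk _ p

theorem SymmetricQuotient.exists_mk_eq (q : SymmetricQuotient R) :
    ∃ p : QuotientRep R, mk p = q :=
  Quotient.exists_rep q

theorem toQuotient_injective : Function.Injective (toQuotient R) := by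
  refine (injective_iff_map_eq_zero _).2 fun r hr => ?_
  obtain ⟨J, hJ, -, -, h⟩ : QuotientRep.ofElem r ≈ QuotientRep.ofElem 0 := Quotient.exact hr
  exact eq_zero_of_forall_mul_right hJ fun x hx => ((h x hx).1 : r * x = 0 * x).trans (zero_mul x)

theorem mk_mul_toQuotient (p : QuotientRep R) {x : R} (hx : x ∈ p.dom) :
    SymmetricQuotient.mk p * toQuotient R x = toQuotient R (p.left x) := by
  refine Quotient.sound (QuotientRep.equiv_of_agree
    (p := .mul p (.ofElem x)) (q := .ofElem (p.left x)) fun y hy _ => ⟨p.left_mul x hx y, ?_⟩)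
  exact p.compat y (idealMul_le_right hy) x hx

theorem toQuotient_mul_mk (p : QuotientRep R) {x : R} (hx : x ∈ p.dom) :
    toQuotient R x * SymmetricQuotient.mk p = toQuotient R (p.right x) := by
  refine Quotient.sound (QuotientRep.equiv_of_agree
    (p := .mul (.ofElem x) p) (q := .ofElem (p.right x)) fun y hy _ => ⟨?_, p.right_mul x hx y⟩)
  exact (p.compat x hx y (idealMul_le_left hy)).symm

theorem exists_ideal_mul_mem (q : SymmetricQuotient R) : ∃ J : TwoSidedIdeal R, J ≠ ⊥ ∧
    ∀ x ∈ J, (∃ y, q * toQuotient R x = toQuotient R y) ∧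
      ∃ y, toQuotient R x * q = toQuotient R y := by
  obtain ⟨p, rfl⟩ := q.exists_mk_eq
  exact ⟨p.dom, p.dom_ne_bot, fun x hx =>
    ⟨⟨_, mk_mul_toQuotient p hx⟩, ⟨_, toQuotient_mul_mk p hx⟩⟩⟩

theorem eq_zero_of_forall_mul_toQuotient {q : SymmetricQuotient R} {J : TwoSidedIdeal R}
    (hJ : J ≠ ⊥) (h : ∀ x ∈ J, q * toQuotient R x = 0) : q = 0 := by
  obtain ⟨p, rfl⟩ := q.exists_mk_eq
  have hl : ∀ x ∈ J ⊓ p.dom, p.left x = 0 := fun x hx => by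
    have hx' : x ∈ p.dom := (inf_le_right : J ⊓ p.dom ≤ _) hx
    refine toQuotient_injective ?_
    rw [← mk_mul_toQuotient p hx', map_zero]
    exact h x ((inf_le_left : J ⊓ p.dom ≤ _) hx)
  refine Quotient.sound ⟨J ⊓ p.dom, inf_ne_bot hJ p.dom_ne_bot, inf_le_right, le_top,
    fun x hx => ⟨(hl x hx).trans (zero_mul x).symm, ?_⟩⟩
  refine Eq.trans ?_ (mul_zero x).symm
  refine eq_zero_of_forall_mul_right (inf_ne_bot hJ p.dom_ne_bot) fun y hy => ?_
  rw [p.compat x ((inf_le_right : J ⊓ p.dom ≤ _) hx) y ((inf_le_right : J ⊓ p.dom ≤ _) hy),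
    hl y hy, mul_zero]

theorem eq_zero_of_forall_toQuotient_mul {q : SymmetricQuotient R} {J : TwoSidedIdeal R}
    (hJ : J ≠ ⊥) (h : ∀ x ∈ J, toQuotient R x * q = 0) : q = 0 := by
  obtain ⟨I, hI, hq⟩ := exists_ideal_mul_mem q
  refine eq_zero_of_forall_mul_toQuotient hI fun x hx => ?_
  obtain ⟨y, hy⟩ := (hq x hx).1
  rw [hy, ← map_zero (toQuotient R)]
  congr 1
  refine eq_zero_of_forall_mul_left hJ fun z hz => toQuotient_injective ?_
  rw [map_mul, ← hy, ← mul_assoc, h z hz, zero_mul, map_zero]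

theorem eq_zero_or_eq_zero_of_forall_mul {p q : SymmetricQuotient R}
    (h : ∀ x, p * toQuotient R x * q = 0) : p = 0 ∨ q = 0 := by
  by_contra! hpq
  obtain ⟨I, hI, hp⟩ := exists_ideal_mul_mem p
  obtain ⟨J, hJ, hq⟩ := exists_ideal_mul_mem q
  refine hpq.1 (eq_zero_of_forall_mul_toQuotient hI fun x hx => ?_)
  by_contra hx0
  refine hpq.2 (eq_zero_of_forall_toQuotient_mul hJ fun y hy => ?_)
  obtain ⟨a, ha⟩ := (hp x hx).1
  obtain ⟨b, hb⟩ := (hq y hy).2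
  have : a = 0 ∨ b = 0 := IsPrimeRing.eq_zero_or_eq_zero a b fun r => toQuotient_injective (by
    rw [map_mul, map_mul, ← ha, ← hb, map_zero, ← zero_mul (1 : SymmetricQuotient R),
      ← h (x * r * y)]
    simp only [map_mul, mul_assoc, mul_one])
  rcases this with rfl | rfl
  · exact (hx0 (by simpa using ha)).elim
  · simpa using hb

theorem mem_center_of_forall_commute {q : SymmetricQuotient R}
    (h : ∀ x, toQuotient R x * q = q * toQuotient R x) :
    q ∈ Subring.center (SymmetricQuotient R) := by
  refine Subring.mem_center_iff.2 fun p => sub_eq_zero.1 ?_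
  obtain ⟨J, hJ, hp⟩ := exists_ideal_mul_mem p
  refine eq_zero_of_forall_mul_toQuotient hJ fun x hx => ?_
  obtain ⟨y, hy⟩ := (hp x hx).1
  rw [sub_mul, mul_assoc, ← h, ← mul_assoc, hy, h, mul_assoc, hy, sub_self]

theorem toQuotient_mem_center {a : R} :
    toQuotient R a ∈ Subring.center (SymmetricQuotient R) ↔ a ∈ NonUnitalSubring.center R := by
  refine ⟨fun h => NonUnitalSubring.mem_center_iff.2 fun x => toQuotient_injective ?_,
    fun h => mem_center_of_forall_commute fun x => ?_⟩
  · rw [map_mul, map_mul, Subring.mem_center_iff.1 h]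
  · rw [← map_mul, ← map_mul, NonUnitalSubring.mem_center_iff.1 h]

theorem exists_forall_toQuotient_eq_smul {J : TwoSidedIdeal R} (hJ : J ≠ ⊥) {f : R → R}
    (h_add : ∀ x ∈ J, ∀ y ∈ J, f (x + y) = f x + f y)
    (h_mul_right : ∀ x ∈ J, ∀ r, f (x * r) = f x * r)
    (h_mul_left : ∀ x ∈ J, ∀ r, f (r * x) = r * f x) :
    ∃ l : ExtendedCentroid R, ∀ x ∈ J, toQuotient R (f x) = l • toQuotient R x := by
  let p : QuotientRep R :=
    { dom := J
      dom_ne_bot := hJ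
      left := f
      right := f
      left_add := h_add
      left_mul := h_mul_right
      right_add := h_add
      right_mul := h_mul_left
      compat := fun x hx y hy => (h_mul_right x hx y).symm.trans (h_mul_left y hy x) }
  have hp : SymmetricQuotient.mk p ∈ Subring.center (SymmetricQuotient R) := by
    refine mem_center_of_forall_commute fun r => sub_eq_zero.1 ?_
    refine eq_zero_of_forall_mul_toQuotient hJ fun x hx => ?_
    rw [sub_mul, mul_assoc, mul_assoc, mk_mul_toQuotient p hx, ← map_mul, ← map_mul,
      mk_mul_toQuotient p (J.mul_mem_left _ _ hx), sub_eq_zero]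
    exact congrArg _ (h_mul_left x hx r).symm
  exact ⟨⟨_, hp⟩, fun x hx => (mk_mul_toQuotient p hx).symm⟩

/-- The ideal of all `y ∈ R` for which `y (c / a)` is an element `z` of `R`. The quotient `c / a`,
which is meant to lie in `C`, is cleared from `z = y (c / a)` by multiplying with `x a`. -/
def denominatorIdeal (a c : SymmetricQuotient R) : TwoSidedIdeal R :=
  TwoSidedIdeal.mk'
    {y | ∃ z, ∀ x, toQuotient R z * toQuotient R x * a = toQuotient R y * toQuotient R x * c}
    ⟨0, fun x => by simp only [map_zero, zero_mul]⟩
    (by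
      rintro y y' ⟨z, hz⟩ ⟨z', hz'⟩
      exact ⟨z + z', fun x => by simp only [map_add, add_mul, hz, hz']⟩)
    (by
      rintro y ⟨z, hz⟩
      exact ⟨-z, fun x => by simp only [map_neg, neg_mul, hz]⟩)
    (by
      rintro r y ⟨z, hz⟩
      refine ⟨r * z, fun x => ?_⟩
      simpa only [map_mul, mul_assoc] using congrArg (toQuotient R r * ·) (hz x))
    (by
      rintro y r ⟨z, hz⟩
      refine ⟨z * r, fun x => ?_⟩
      simpa only [map_mul, mul_assoc] using hz (r * x))

theorem mem_denominatorIdeal {a c : SymmetricQuotient R} {y : R} : y ∈ denominatorIdeal a c ↔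
    ∃ z, ∀ x, toQuotient R z * toQuotient R x * a = toQuotient R y * toQuotient R x * c := by
  simp [denominatorIdeal]

theorem denominatorIdeal_ne_bot {a b c : SymmetricQuotient R} (ha : a ≠ 0)
    (h : ∀ x, a * toQuotient R x * c = b * toQuotient R x * a) : denominatorIdeal a c ≠ ⊥ := by
  obtain ⟨I, hI, hIa⟩ := exists_ideal_mul_mem a
  obtain ⟨J, hJ, hJb⟩ := exists_ideal_mul_mem b
  obtain ⟨s, hs, hs0⟩ : ∃ s ∈ I ⊓ J, toQuotient R s * a ≠ 0 := by
    by_contra! hs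
    exact ha (eq_zero_of_forall_toQuotient_mul (inf_ne_bot hI hJ) hs)
  obtain ⟨y, hy⟩ := (hIa s ((inf_le_left : I ⊓ J ≤ I) hs)).2
  obtain ⟨z, hz⟩ := (hJb s ((inf_le_right : I ⊓ J ≤ J) hs)).2
  refine ne_bot_of_mem (mem_denominatorIdeal.2 ⟨z, fun x => ?_⟩) fun hy0 : y = 0 =>
    hs0 (by rw [hy, hy0, map_zero])
  simpa only [mul_assoc, ← hy, ← hz] using congrArg (toQuotient R s * ·) (h x).symm

/-- Martindale's lemma. -/
theorem exists_smul_eq {a b c : SymmetricQuotient R} (ha : a ≠ 0)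
    (h : ∀ x, a * toQuotient R x * c = b * toQuotient R x * a) :
    ∃ l : ExtendedCentroid R, b = l • a ∧ c = l • a := by
  have hJ := denominatorIdeal_ne_bot ha h
  have eq_of_forall {z z' : R} (hz : ∀ x, toQuotient R z * toQuotient R x * a =
      toQuotient R z' * toQuotient R x * a) : z = z' := by
    refine toQuotient_injective (sub_eq_zero.1 ?_)
    refine (eq_zero_or_eq_zero_of_forall_mul fun x => ?_).resolve_right ha
    rw [sub_mul, sub_mul, hz, sub_self]
  have h_div : ∀ y ∈ denominatorIdeal a c, ∃ z, ∀ x,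
      toQuotient R z * toQuotient R x * a = toQuotient R y * toQuotient R x * c :=
    fun y hy => mem_denominatorIdeal.1 hy
  choose! f hf using h_div
  obtain ⟨l, hl⟩ := exists_forall_toQuotient_eq_smul hJ (f := f)
    (fun x hx y hy => eq_of_forall fun w => by
      simp only [hf _ (add_mem hx hy), map_add, add_mul, hf x hx, hf y hy])
    (fun x hx r => eq_of_forall fun w => by
      simpa only [hf _ (TwoSidedIdeal.mul_mem_right _ _ _ hx), map_mul, mul_assoc] using
        (hf x hx (r * w)).symm)
    (fun x hx r => eq_of_forall fun w => by
      simpa only [hf _ (TwoSidedIdeal.mul_mem_left _ _ _ hx), map_mul, mul_assoc] using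
        congrArg (toQuotient R r * ·) (hf x hx w).symm)
  have hc : c = l • a := by
    obtain ⟨y, hy, hy0⟩ := exists_mem_ne_zero hJ
    refine sub_eq_zero.1 ((eq_zero_or_eq_zero_of_forall_mul (p := toQuotient R y)
      fun x => ?_).resolve_left ((map_ne_zero_iff _ toQuotient_injective).2 hy0))
    rw [mul_sub, ← hf y hy x, hl y hy, mul_smul_comm, smul_mul_assoc, smul_mul_assoc, sub_self]
  refine ⟨l, sub_eq_zero.1 ((eq_zero_or_eq_zero_of_forall_mul fun x => ?_).resolve_right ha), hc⟩
  rw [sub_mul, sub_mul, ← h x, hc, mul_smul_comm, smul_mul_assoc, smul_mul_assoc, sub_self]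

instance : Nontrivial (SymmetricQuotient R) := by
  obtain ⟨x, hx⟩ := exists_ne (0 : R)
  exact ⟨toQuotient R x, 0, fun h => hx (toQuotient_injective (h.trans (map_zero _).symm))⟩

theorem isUnit_or_eq_zero (l : ExtendedCentroid R) : IsUnit l ∨ l = 0 := by
  refine or_iff_not_imp_right.2 fun hl => ?_
  have hl0 : (l : SymmetricQuotient R) ≠ 0 := fun h => hl (Subtype.ext h)
  obtain ⟨k, hk, -⟩ := exists_smul_eq (a := (l : SymmetricQuotient R)) (b := 1) (c := 1) hl0
    fun x => by rw [mul_one, one_mul, Subring.mem_center_iff.1 l.2]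
  exact IsUnit.of_mul_eq_one_right k (Subtype.ext hk.symm)

/-- The field structure on `C`, extending its ring structure as a subring of `Q_s(R)`. -/
noncomputable abbrev extendedCentroidField : Field (ExtendedCentroid R) :=
  Field.ofIsUnitOrEqZero isUnit_or_eq_zero

end Quotient

section CentralSpan

variable {R : Type*} [NonUnitalRing R]

theorem commutator_eq_bot_iff_forall_commute {A B : Set R} :
    commutator A B = ⊥ ↔ ∀ a ∈ A, ∀ b ∈ B, Commute a b := by
  rw [eq_bot_iff, commutator, AddSubgroup.closure_le]
  refine ⟨fun h a ha b hb => sub_eq_zero.1 (h ⟨a, ha, b, hb, rfl⟩), ?_⟩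
  rintro h _ ⟨a, ha, b, hb, rfl⟩
  exact sub_eq_zero.2 (h a ha b hb)

theorem power_succ (A : Set R) {m : ℕ} (hm : 1 ≤ m) :
    power A (m + 1) = product (power A m : Set R) A := by
  obtain ⟨m, rfl⟩ := Nat.exists_eq_add_of_le' hm
  rfl

variable [IsPrimeRing R]

attribute [local instance] extendedCentroidField LieRing.ofAssociativeRing

theorem mem_one_iff_mem_center {q : SymmetricQuotient R} :
    q ∈ (1 : Submodule (ExtendedCentroid R) (SymmetricQuotient R)) ↔
      q ∈ Subring.center (SymmetricQuotient R) := by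
  refine Submodule.mem_one.trans ⟨?_, fun hq => ⟨⟨q, hq⟩, rfl⟩⟩
  rintro ⟨l, rfl⟩
  exact l.2

theorem toQuotient_mem_one {a : R} :
    toQuotient R a ∈ (1 : Submodule (ExtendedCentroid R) (SymmetricQuotient R)) ↔
      a ∈ NonUnitalSubring.center R :=
  mem_one_iff_mem_center.trans toQuotient_mem_center

theorem toQuotient_mem_centralSpan {A : Set R} {a : R} (ha : a ∈ A) :
    toQuotient R a ∈ centralSpan A :=
  Submodule.subset_span ⟨a, ha, rfl⟩

theorem centralSpan_le_iff {A : Set R}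
    {V : Submodule (ExtendedCentroid R) (SymmetricQuotient R)} :
    centralSpan A ≤ V ↔ ∀ a ∈ A, toQuotient R a ∈ V :=
  Submodule.span_le.trans Set.forall_mem_image

theorem isCentral_iff_centralSpan_le_one {K : AddSubgroup R} :
    IsCentral K ↔ centralSpan (K : Set R) ≤ 1 := by
  simp only [centralSpan_le_iff, toQuotient_mem_one, IsCentral, SetLike.mem_coe]

theorem centralSpan_closure (A : Set R) :
    centralSpan (AddSubgroup.closure A : Set R) = centralSpan A := by
  refine le_antisymm (centralSpan_le_iff.2 ?_)
    (Submodule.span_mono (Set.image_mono AddSubgroup.subset_closure))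
  exact (AddSubgroup.closure_le ((centralSpan A).toAddSubgroup.comap
    (toQuotient R : R →+ SymmetricQuotient R))).2 fun _ => toQuotient_mem_centralSpan

theorem centralSpan_product (A B : Set R) :
    centralSpan (product A B : Set R) = centralSpan A * centralSpan B := by
  refine le_antisymm ((centralSpan_closure _).trans_le (centralSpan_le_iff.2 ?_)) ?_
  · rintro _ ⟨a, ha, b, hb, rfl⟩
    rw [map_mul]
    exact Submodule.mul_mem_mul (toQuotient_mem_centralSpan ha) (toQuotient_mem_centralSpan hb)
  · rw [centralSpan, centralSpan, Submodule.span_mul_span, Submodule.span_le]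
    rintro _ ⟨_, ⟨a, ha, rfl⟩, _, ⟨b, hb, rfl⟩, rfl⟩
    have hab : toQuotient R (a * b) ∈ centralSpan (product A B : Set R) :=
      toQuotient_mem_centralSpan (AddSubgroup.subset_closure ⟨a, ha, b, hb, rfl⟩)
    rwa [map_mul] at hab

theorem centralSpan_power (A : Set R) {m : ℕ} (hm : 1 ≤ m) :
    centralSpan (power A m : Set R) = centralSpan A ^ m := by
  induction m, hm using Nat.le_induction with
  | base => exact (centralSpan_closure A).trans (pow_one _).symm
  | succ m hm ih => rw [power_succ A hm, centralSpan_product, ih, pow_succ]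

theorem commutator_eq_bot_iff {A B : Set R} :
    commutator A B = ⊥ ↔ ∀ v ∈ centralSpan A, ∀ w ∈ centralSpan B, Commute v w := by
  rw [commutator_eq_bot_iff_forall_commute]
  refine ⟨fun h v hv w hw => ?_, fun h a ha b hb => toQuotient_injective ?_⟩
  · induction hv, hw using Submodule.span_induction₂ with
    | mem_mem p q hp hq =>
      obtain ⟨a, ha, rfl⟩ := hp
      obtain ⟨b, hb, rfl⟩ := hq
      exact (h a ha b hb).map (toQuotient R)
    | zero_left q _ => exact Commute.zero_left q
    | zero_right p _ => exact Commute.zero_right p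
    | add_left _ _ _ _ _ _ h₁ h₂ => exact h₁.add_left h₂
    | add_right _ _ _ _ _ _ h₁ h₂ => exact h₁.add_right h₂
    | smul_left l _ _ _ _ h => exact h.smul_left l
    | smul_right l _ _ _ _ h => exact h.smul_right l
  · rw [map_mul, map_mul]
    exact h _ (toQuotient_mem_centralSpan ha) _ (toQuotient_mem_centralSpan hb)

theorem isCentrallyClosed_centralSpan_univ :
    IsCentrallyClosed (centralSpan (Set.univ : Set R)) where
  mul_le := by
    rw [← centralSpan_product]
    exact Submodule.span_mono (Set.image_mono (Set.subset_univ _))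
  eq_zero_or_eq_zero _ _ h :=
    eq_zero_or_eq_zero_of_forall_mul fun _ => h _ (toQuotient_mem_centralSpan trivial)
  exists_smul_eq _ _ _ ha h :=
    exists_smul_eq ha fun _ => h _ (toQuotient_mem_centralSpan trivial)

theorem isLieIdealIn_centralSpan {K : AddSubgroup R} (hK : IsLieIdeal K) :
    IsLieIdealIn (centralSpan (Set.univ : Set R)) (centralSpan (K : Set R)) where
  le := Submodule.span_mono (Set.image_mono (Set.subset_univ _))
  lie_mem v hv x hx := by
    induction hv, hx using Submodule.span_induction₂ with
    | mem_mem p q hp hq =>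
      obtain ⟨a, ha, rfl⟩ := hp
      obtain ⟨r, -, rfl⟩ := hq
      rw [Ring.lie_def, ← map_mul, ← map_mul, ← map_sub]
      exact toQuotient_mem_centralSpan
        (hK (AddSubgroup.subset_closure ⟨a, ha, r, trivial, rfl⟩))
    | zero_left q _ =>
      rw [zero_lie]
      exact zero_mem _
    | zero_right p _ =>
      rw [lie_zero]
      exact zero_mem _
    | add_left p q r _ _ _ h₁ h₂ =>
      rw [add_lie]
      exact add_mem h₁ h₂
    | add_right p q r _ _ _ h₁ h₂ =>
      rw [lie_add]
      exact add_mem h₁ h₂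
    | smul_left l p q _ _ h =>
      rw [Ring.lie_def, smul_mul_assoc, mul_smul_comm, ← smul_sub, ← Ring.lie_def]
      exact Submodule.smul_mem _ l h
    | smul_right l p q _ _ h =>
      rw [Ring.lie_def, smul_mul_assoc, mul_smul_comm, ← smul_sub, ← Ring.lie_def]
      exact Submodule.smul_mem _ l h

theorem isExceptional_of_isInseparable {b : SymmetricQuotient R}
    (hb : IsInseparable (centralSpan (Set.univ : Set R)) b) : IsExceptional R := by
  refine ⟨(AddMonoid.exponent_eq_prime_iff Nat.prime_two).2 fun a ha => ?_,
    hb.finrank_eq_four isCentrallyClosed_centralSpan_univ⟩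
  have := hb.char_two
  refine addOrderOf_eq_prime (toQuotient_injective ?_) ha
  rw [two_nsmul, map_add, map_zero, CharTwo.add_self_eq_zero]

theorem commutator_power_eq_bot {A B : Set R} {m n : ℕ} (hm : 1 ≤ m) (hn : 1 ≤ n)
    (h : commutator A B = ⊥) : commutator (power A m : Set R) (power B n : Set R) = ⊥ := by
  rw [commutator_eq_bot_iff, centralSpan_power A hm, centralSpan_power B hn]
  exact commute_pow_pow (commutator_eq_bot_iff.1 h) m n

theorem commutator_eq_bot_of_commutator_power_eq_bot {K L : AddSubgroup R} (hK : IsLieIdeal K)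
    (hL : IsLieIdeal L) (hKZ : ¬ IsCentral K) (hLZ : ¬ IsCentral L) {m n : ℕ} (hm : 1 ≤ m)
    (hn : 1 ≤ n) (h : commutator (power (K : Set R) m : Set R) (power (L : Set R) n : Set R) = ⊥) :
    commutator (K : Set R) (L : Set R) = ⊥ := by
  rw [commutator_eq_bot_iff, centralSpan_power _ hm, centralSpan_power _ hn] at h
  exact commutator_eq_bot_iff.2 <| isCentrallyClosed_centralSpan_univ.commute_of_commute_pow
    (isLieIdealIn_centralSpan hK) (isLieIdealIn_centralSpan hL)
    (mt isCentral_iff_centralSpan_le_one.2 hKZ) (mt isCentral_iff_centralSpan_le_one.2 hLZ) hm hn h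

theorem isInseparable_toQuotient {K L : AddSubgroup R} (hK : IsLieIdeal K) (hL : IsLieIdeal L)
    (hKZ : ¬ IsCentral K) (h : commutator (K : Set R) (L : Set R) = ⊥) {a : R} (ha : a ∈ L)
    (haZ : a ∉ NonUnitalSubring.center R) :
    IsInseparable (centralSpan (Set.univ : Set R)) (toQuotient R a) :=
  isCentrallyClosed_centralSpan_univ.isInseparable_of_commute
    (isLieIdealIn_centralSpan hK) (isLieIdealIn_centralSpan hL)
    (mt isCentral_iff_centralSpan_le_one.2 hKZ) (commutator_eq_bot_iff.1 h)
    (toQuotient_mem_centralSpan ha) (mt toQuotient_mem_one.1 haZ)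

theorem centralSpan_eq_affineSpan_left {K L : AddSubgroup R} (hK : IsLieIdeal K)
    (hL : IsLieIdeal L) (hKZ : ¬ IsCentral K) (h : commutator (K : Set R) (L : Set R) = ⊥) {a : R}
    (ha : a ∈ L) (haZ : a ∉ NonUnitalSubring.center R) :
    centralSpan (K : Set R) = affineSpan (ExtendedCentroid R) (toQuotient R a) :=
  (isInseparable_toQuotient hK hL hKZ h ha haZ).eq_affineSpan
    isCentrallyClosed_centralSpan_univ (isLieIdealIn_centralSpan hK)
    (isCentrallyClosed_centralSpan_univ.le_affineSpan_of_commute (isLieIdealIn_centralSpan hL)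
      (commutator_eq_bot_iff.1 h) (toQuotient_mem_centralSpan ha) (mt toQuotient_mem_one.1 haZ))
    (mt isCentral_iff_centralSpan_le_one.2 hKZ)

theorem centralSpan_eq_affineSpan_right {K L : AddSubgroup R} (hK : IsLieIdeal K)
    (hL : IsLieIdeal L) (hKZ : ¬ IsCentral K) (h : commutator (K : Set R) (L : Set R) = ⊥) {a : R}
    (ha : a ∈ L) (haZ : a ∉ NonUnitalSubring.center R) :
    centralSpan (L : Set R) = affineSpan (ExtendedCentroid R) (toQuotient R a) :=
  (isInseparable_toQuotient hK hL hKZ h ha haZ).eq_affineSpan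
    isCentrallyClosed_centralSpan_univ (isLieIdealIn_centralSpan hL)
    (isCentrallyClosed_centralSpan_univ.le_affineSpan_of_commute_self
      (isLieIdealIn_centralSpan hK) (isLieIdealIn_centralSpan hL)
      (mt isCentral_iff_centralSpan_le_one.2 hKZ) (commutator_eq_bot_iff.1 h)
      (toQuotient_mem_centralSpan ha) (mt toQuotient_mem_one.1 haZ))
    fun hL1 => haZ (isCentral_iff_centralSpan_le_one.2 hL1 a ha)

theorem commutator_eq_bot_of_centralSpan_eq_affineSpan {A B : Set R} {q : SymmetricQuotient R}
    (hA : centralSpan A = affineSpan (ExtendedCentroid R) q)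
    (hB : centralSpan B = affineSpan (ExtendedCentroid R) q) : commutator A B = ⊥ := by
  rw [commutator_eq_bot_iff, hA, hB]
  exact fun _ hv _ hw => commute_of_mem_affineSpan hv hw

end CentralSpan

end PrimeLie

theorem theoremC {R : Type*} [NonUnitalRing R] [PrimeLie.IsPrimeRing R]
    (K L : AddSubgroup R) (hK : PrimeLie.IsLieIdeal K) (hL : PrimeLie.IsLieIdeal L)
    (hKZ : ¬ PrimeLie.IsCentral K) (hLZ : ¬ PrimeLie.IsCentral L)
    (m n : ℕ) (hm : 1 ≤ m) (hn : 1 ≤ n) :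
    List.TFAE [
      PrimeLie.commutator (PrimeLie.power (K : Set R) m : Set R)
        (PrimeLie.power (L : Set R) n : Set R) = ⊥,
      PrimeLie.commutator (K : Set R) (L : Set R) = ⊥,
      PrimeLie.IsExceptional R ∧
        ∀ a ∈ L, a ∉ NonUnitalSubring.center R →
          PrimeLie.centralSpan (K : Set R) = PrimeLie.centralSpan (L : Set R) ∧
          PrimeLie.centralSpan (L : Set R) =
            Submodule.span (PrimeLie.ExtendedCentroid R) {PrimeLie.toQuotient R a, 1}] := by
  tfae_have 2 → 1 := PrimeLie.commutator_power_eq_bot hm hn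
  tfae_have 1 → 2 :=
    PrimeLie.commutator_eq_bot_of_commutator_power_eq_bot hK hL hKZ hLZ hm hn
  obtain ⟨b, hb, hbZ⟩ : ∃ b ∈ L, b ∉ NonUnitalSubring.center R := by
    simpa only [PrimeLie.IsCentral, not_forall, exists_prop] using hLZ
  tfae_have 2 → 3 := fun h =>
    ⟨PrimeLie.isExceptional_of_isInseparable
        (PrimeLie.isInseparable_toQuotient hK hL hKZ h hb hbZ), fun a ha haZ =>
      have hK_eq := PrimeLie.centralSpan_eq_affineSpan_left hK hL hKZ h ha haZ
      have hL_eq := PrimeLie.centralSpan_eq_affineSpan_right hK hL hKZ h ha haZ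
      ⟨hK_eq.trans hL_eq.symm, hL_eq⟩⟩
  tfae_have 3 → 2 := fun ⟨_, h⟩ =>
    have ⟨hKL, hL_eq⟩ := h b hb hbZ
    PrimeLie.commutator_eq_bot_of_centralSpan_eq_affineSpan (hKL.trans hL_eq) hL_eq
  tfae_finish
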